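/- Let $\mathcal N$ be a finite set of users and $\mathbf T=\{1,\dots,T\}$. Let $p_1>0$, $\gamma>0$, and $\omega_t<0$, $\bar\psi_t^i\ge 0$, $\alpha_t^i>0$ for $i\in\mathcal N$, $t\in\mathbf T$. Given a supply schedule $\mathbf s=(s_t)_{t\in\mathbf T}\in\mathbf R_+^T$ and demand schedules $\mathbf d^i=(d^i_t)_{t\in\mathbf T}\in\mathbf R_+^T$, the price evolves by $p_{t+1}=(1+\omega_t)p_t+\gamma\big(\sum_{i\in\mathcal N}d_t^i-s_t\big)$, $t\in\mathbf T$, from the initial price $p_1$, and user $i$ has the cost $$C^i(\mathbf d^i,\mathbf d^{-i},\mathbf s)=\sum_{t=1}^T\Big(-\bar\psi_t^i d_t^i+p_t d_t^i+\tfrac12\alpha_t^i (d_t^i)^2\Big).$$ A Nash equilibrium response to $\mathbf s$ is a profile $(\hat{\mathbf d}^i)_{i\in\mathcal N}$ in $\mathbf R_+^T$ such that $C^i(\hat{\mathbf d}^i,\hat{\mathbf d}^{-i},\mathbf s)\le C^i(\mathbf d^i,\hat{\mathbf d}^{-i},\mathbf s)$ for all $i\in\mathcal N$ and all $\mathbf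 d^i\in\mathbf R_+^T$ (the price moving along with $\mathbf d^i$). Let $\mathbf s\in\mathbf R_+^T$ be any announced supply schedule. (a) For every Nash equilibrium response $\hat d$ to $\mathbf s$ there are prices $\hat p_1,\dots,\hat p_{T+1}$ and costates $\lambda_1^i,\dots,\lambda_{T+1}^i$ ($i\in\mathcal N$) such that for all $i\in\mathcal N$ and $t\in\mathbf T$ $$\hat p_{t+1}=(1+\omega_t)\hat p_t+\gamma\Big(\sum_{j\in\mathcal N}\hat d_t^j-s_t\Big),\qquad \hat p_1=p_1,$$ $$\hat d_t^i=\max\Big\{\frac{\bar\psi_t^i-\hat p_t-\gamma\lambda_{t+1}^i}{\alpha_t^i},\,0\Big\},$$ $$\lambda_t^i=(1+\omega_t)\lambda_{t+1}^i+\hat d_t^i,\qquad \lambda_{T+1}^i=0.$$ (b) If $\omega_t\ge-1$ for all $t\in\mathbf T$ and each $C^i$ is convex in user $i$'s own schedule $\mathbf d^i\in\mathbf R_+^T$, then there exists a Nash equilibrium response $\hat d$ to $\mathbf s$, with prices and costates satisfying the relations in (a). -/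

import Mathlib

/-- Parameters of the deterministic affine-quadratic game played by the users (the followers) on
the time slots `1, …, T`.  The slot `t ∈ {1, …, T}` is the index `t - 1 : Fin T`. -/
structure DemandGame (ι : Type*) (T : ℕ) where
  /-- initial price `p₁` -/
  p₁ : ℝ
  /-- stickiness parameters `ω_t` of the price -/
  ω : Fin T → ℝ
  /-- gain `γ` of the price in response to the excess demand -/
  γ : ℝ
  /-- utility coefficients `ψ̄_t^i` -/
  ψ : ι → Fin T → ℝ
  /-- adjustment cost coefficients `α_t^i` -/
  α : ι → Fin T → ℝ

namespace DemandGame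

variable {ι : Type*} [Fintype ι] {T : ℕ}

/-- The standing assumptions on the parameters: `p₁ > 0`, `ω_t < 0`, `γ > 0` (the price is driven up
by demand and down by supply), `ψ̄_t^i ≥ 0` and `α_t^i > 0`. -/
structure Admissible (G : DemandGame ι T) : Prop where
  p₁_pos : 0 < G.p₁
  ω_neg : ∀ t, G.ω t < 0
  γ_pos : 0 < G.γ
  ψ_nonneg : ∀ i t, 0 ≤ G.ψ i t
  α_pos : ∀ i t, 0 < G.α i t

/-- The prices `p₁, …, p_{T+1}` generated by the supply schedule `s` and the demand profile `d`:
`p_{t+1} = (1 + ω_t) p_t + γ (∑ i, d_t^i - s_t)`.  For a slot `t : Fin T`, the price `p_t` is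
`G.price s d t.castSucc` and `p_{t+1}` is `G.price s d t.succ`. -/
noncomputable def price (G : DemandGame ι T) (s : Fin T → ℝ) (d : ι → Fin T → ℝ) :
    Fin (T + 1) → ℝ :=
  Fin.induction G.p₁ fun t p => (1 + G.ω t) * p + G.γ * (∑ i, d i t - s t)

/-- The cost `∑_t (-ψ̄_t^i d_t^i + p_t d_t^i + ½ α_t^i (d_t^i)²)` of user `i`. -/
noncomputable def cost (G : DemandGame ι T) (s : Fin T → ℝ) (d : ι → Fin T → ℝ) (i : ι) : ℝ :=
  ∑ t : Fin T, (-(G.ψ i t * d i t) + G.price s d t.castSucc * d i t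
    + 1 / 2 * G.α i t * d i t ^ 2)

/-- `d` is an (open-loop) Nash equilibrium of the users given the supply schedule `s`: all demand
schedules are nonnegative, and no user can lower the cost by switching to another nonnegative demand
schedule, the price moving along. -/
def IsNash [DecidableEq ι] (G : DemandGame ι T) (s : Fin T → ℝ) (d : ι → Fin T → ℝ) : Prop :=
  (∀ i t, 0 ≤ d i t) ∧
    ∀ i, ∀ x : Fin T → ℝ, (∀ t, 0 ≤ x t) → G.cost s d i ≤ G.cost s (Function.update d i x) i

/-- Given the supply schedule `s`, the cost of every user is a convex function of the user's own
nonnegative demand schedule, the demand schedules of the other users being fixed. -/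
def OwnCostConvex [DecidableEq ι] (G : DemandGame ι T) (s : Fin T → ℝ) : Prop :=
  ∀ (d : ι → Fin T → ℝ) (i : ι),
    ConvexOn ℝ {x : Fin T → ℝ | ∀ t, 0 ≤ x t} fun x => G.cost s (Function.update d i x) i

/-- The relations of the minimum principle for the demand profile `d`, the prices `p = (p_t)` and
the costates `l = (λ_t^i)`, `t = 1, …, T + 1`: the price recursion, the projected first-order
condition and the backward costate recursion. -/
structure NashRelations (G : DemandGame ι T) (s : Fin T → ℝ) (d : ι → Fin T → ℝ)
    (p : Fin (T + 1) → ℝ) (l : ι → Fin (T + 1) → ℝ) : Prop where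
  price_init : p 0 = G.p₁
  price_step : ∀ t : Fin T,
    p t.succ = (1 + G.ω t) * p t.castSucc + G.γ * (∑ i, d i t - s t)
  response : ∀ (i : ι) (t : Fin T),
    d i t = max ((G.ψ i t - p t.castSucc - G.γ * l i t.succ) / G.α i t) 0
  costate_final : ∀ i : ι, l i (Fin.last T) = 0
  costate_step : ∀ (i : ι) (t : Fin T),
    l i t.castSucc = (1 + G.ω t) * l i t.succ + d i t

end DemandGame

/-! A user's cost is quadratic in the own schedule. Summation by parts against the costates
identifies its linear part, the marginal cost, so the relations in (a) are a projected form of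
complementarity: marginal cost nonnegative, and zero where demand is positive. Nash implies
complementarity by varying one slot at a time, with no convexity (`IsNash.isComplementary`). For
(b), a complementary profile is a fixed point of a clipped gradient step, which exists by Brouwer
(`exists_isComplementary`); convexity then makes it Nash (`IsComplementary.isNash`).

Brouwer is proved by the Milnor–Rogers volume argument: a `C¹` retraction onto the sphere would make
a polynomial in `t` equal to the volume of the ball for small `t`, yet zero at `t = 1`. -/

/-! ### Brouwer's fixed point theorem. -/

open Metric MeasureTheory Polynomial in
theorem LinearMap.exists_polynomial_eval_eq_det_one_add_smul {E : Type*} [AddCommGroup E]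
    [Module ℝ E] [FiniteDimensional ℝ E] (A : E →ₗ[ℝ] E) :
    ∃ p : ℝ[X], p.natDegree ≤ Module.finrank ℝ E ∧
      ∀ t : ℝ, p.eval t = LinearMap.det (1 + t • A) := by
  let b := Module.finBasis ℝ E
  refine ⟨Matrix.det ((X : ℝ[X]) • (LinearMap.toMatrix b b A).map C +
    (1 : Matrix _ _ ℝ).map C), ?_, fun t => ?_⟩
  · simpa using natDegree_det_X_add_C_le (LinearMap.toMatrix b b A) 1
  · rw [← LinearMap.det_toMatrix b, eval_det]
    congr 1
    ext i j
    by_cases hij : i = j <;>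
    simp [hij, LinearMap.toMatrix_one, add_comm, mul_comm]

open Metric MeasureTheory Polynomial in
/-- The values of `t ↦ det (1 + t A)` at more than `dim E` nodes determine it by Lagrange
interpolation. -/
theorem ContinuousLinearMap.det_one_add_eq_sum_lagrange {E : Type*} [NormedAddCommGroup E]
    [NormedSpace ℝ E] [FiniteDimensional ℝ E] (s : Finset ℝ)
    (hs : s.card = Module.finrank ℝ E + 1) (A : E →L[ℝ] E) :
    (1 + A).det = ∑ t ∈ s, (Lagrange.basis s id t).eval 1 * (1 + t • A).det := by
  obtain ⟨p, hp, hpe⟩ := LinearMap.exists_polynomial_eval_eq_det_one_add_smul (A : E →ₗ[ℝ] E)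
  have hdeg : p.degree < s.card :=
    (Polynomial.degree_le_natDegree).trans_lt (by rw [hs]; exact_mod_cast Nat.lt_succ_of_le hp)
  have h := Lagrange.eq_interpolate (v := (id : ℝ → ℝ)) (s := s) Function.injective_id.injOn hdeg
  have h1 := congrArg (Polynomial.eval 1) h
  rw [hpe, Lagrange.interpolate_apply, Polynomial.eval_finsetSum] at h1
  simp only [one_smul, id, Polynomial.eval_mul, Polynomial.eval_C, hpe] at h1
  refine h1.trans (Finset.sum_congr rfl fun t _ => ?_)
  rw [mul_comm]
  rfl

open Metric MeasureTheory in
/-- There is no `C¹` retraction of the closed unit ball onto the unit sphere. -/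
theorem not_exists_contDiffAt_retraction_sphere {E : Type*} [NormedAddCommGroup E]
    [InnerProductSpace ℝ E] [FiniteDimensional ℝ E] (r : E → E)
    (hr : ∀ x ∈ closedBall (0 : E) 1, ContDiffAt ℝ 1 r x)
    (hs : ∀ x ∈ sphere (0 : E) 1, r x = x)
    (hn : ∀ x ∈ closedBall (0 : E) 1, ‖r x‖ = 1) : False := by
  let _ : MeasurableSpace E := borel E
  have : BorelSpace E := ⟨rfl⟩
  set h : E → E := fun x => r x - x with h_def
  have hh : ∀ x ∈ closedBall (0 : E) 1, ContDiffAt ℝ 1 h x := fun x hx =>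
    (hr x hx).sub contDiffAt_id
  have hd : ∀ x ∈ closedBall (0 : E) 1, DifferentiableAt ℝ h x := fun x hx =>
    (hh x hx).differentiableAt one_ne_zero
  have hcont : ContinuousOn (fderiv ℝ h) (closedBall 0 1) := fun x hx =>
    ((hh x hx).fderiv_right (m := 0) le_rfl).continuousAt.continuousWithinAt
  obtain ⟨L, hL⟩ := (isCompact_closedBall (0 : E) 1).exists_bound_of_continuousOn hcont
  have hL0 : 0 ≤ L := (norm_nonneg _).trans (hL 0 (by simp))
  have hlip : LipschitzOnWith L.toNNReal h (closedBall 0 1) :=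
    (convex_closedBall (0 : E) 1).lipschitzOnWith_of_nnnorm_fderiv_le hd fun x hx => by
      rw [← NNReal.coe_le_coe, Real.coe_toNNReal _ hL0]; exact hL x hx
  obtain ⟨ε, hε, hdet⟩ : ∃ ε > 0, ∀ B : E →L[ℝ] E, dist B 1 < ε → 0 < B.det :=
    Metric.eventually_nhds_iff.1 (ContinuousLinearMap.continuous_det.continuousAt.eventually
      (lt_mem_nhds (show (0 : ℝ) < (1 : E →L[ℝ] E).det by
        simp [ContinuousLinearMap.det])))
  -- `δ * L < 1` makes `x + t h(x)` injective and open; `δ * L < ε` keeps its Jacobian positive.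
  obtain ⟨δ, hδ, hδ1, hδL, hδε⟩ : ∃ δ : ℝ, 0 < δ ∧ δ ≤ 1 ∧ δ * L < 1 ∧ δ * L < ε := by
    refine ⟨min 1 (min 1 ε / (2 * (L + 1))), by positivity, min_le_left _ _, ?_⟩
    have : min 1 (min 1 ε / (2 * (L + 1))) * L < min 1 ε := by
      calc min 1 (min 1 ε / (2 * (L + 1))) * L ≤ min 1 ε / (2 * (L + 1)) * L :=
            mul_le_mul_of_nonneg_right (min_le_right _ _) hL0
        _ < min 1 ε := by
          rw [div_mul_eq_mul_div, div_lt_iff₀ (by positivity)]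
          have : 0 < min 1 ε := by positivity
          nlinarith
    exact ⟨this.trans_le (min_le_left _ _), this.trans_le (min_le_right _ _)⟩
  have hball : ball (0 : E) 1 ⊆ closedBall 0 1 := ball_subset_closedBall
  -- for small `t`, the map `x ↦ x + t h(x)` is a diffeomorphism of the open ball
  have hvol : ∀ t ∈ Set.Ioo 0 δ,
      ∫ x in ball (0 : E) 1, (1 + t • fderiv ℝ h x).det = volume.real (ball (0 : E) 1) := by
    rintro t ⟨ht0, htδ⟩
    set f : E → E := fun x => x + t • h x with f_def
    have htL : t * L < 1 := (mul_le_mul_of_nonneg_right htδ.le hL0).trans_lt hδL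
    have happ : ApproximatesLinearOn f ((ContinuousLinearEquiv.refl ℝ E : E ≃L[ℝ] E) : E →L[ℝ] E)
        (closedBall 0 1) (t * L).toNNReal := by
      intro x hx y hy
      have := hlip.norm_sub_le hx hy
      rw [Real.coe_toNNReal _ hL0] at this
      rw [Real.coe_toNNReal _ (by positivity)]
      calc _ = ‖t • (h x - h y)‖ := by congr 1; simp [f_def, smul_sub]; abel
        _ = t * ‖h x - h y‖ := by rw [norm_smul, Real.norm_of_nonneg ht0.le]
        _ ≤ t * (L * ‖x - y‖) := by gcongr
        _ = _ := by ring
    have hinj : Set.InjOn f (closedBall 0 1) := by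
      intro x hx y hy hxy
      have h1 := happ x hx y hy
      rw [hxy, sub_self, zero_sub, norm_neg, Real.coe_toNNReal _ (by positivity)] at h1
      have h2 : ‖x - y‖ ≤ t * L * ‖x - y‖ := h1
      have h3 : ‖x - y‖ = 0 := by nlinarith [norm_nonneg (x - y)]
      exact sub_eq_zero.1 (norm_eq_zero.1 h3)
    have hopen : IsOpen (f '' ball 0 1) := by
      refine (happ.mono_set hball).open_image
        (ContinuousLinearEquiv.refl ℝ E).toNonlinearRightInverse isOpen_ball ?_
      rcases subsingleton_or_nontrivial E with hE | hE
      · exact Or.inl hE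
      · right
        have : (ContinuousLinearEquiv.refl ℝ E).toNonlinearRightInverse.nnnorm = 1 := by
          simp [ContinuousLinearEquiv.toNonlinearRightInverse]
        rw [this, inv_one]
        exact Real.toNNReal_lt_one.2 htL
    have hmaps : f '' ball 0 1 ⊆ ball 0 1 := by
      rintro _ ⟨x, hx, rfl⟩
      have hx' : ‖x‖ < 1 := by simpa using hx
      have : f x = (1 - t) • x + t • r x := by simp [f_def, h_def, smul_sub, sub_smul]; abel
      rw [mem_ball_zero_iff, this]
      calc _ ≤ ‖(1 - t) • x‖ + ‖t • r x‖ := norm_add_le _ _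
        _ = (1 - t) * ‖x‖ + t * 1 := by
          rw [norm_smul, norm_smul, hn x (hball hx), Real.norm_of_nonneg ht0.le,
            Real.norm_of_nonneg (by linarith)]
        _ < 1 := by nlinarith
    have hfc : ContinuousOn f (closedBall 0 1) :=
      continuousOn_id.add (continuousOn_const.smul hlip.continuousOn)
    have hclosed : IsClosed (f '' closedBall 0 1) :=
      ((isCompact_closedBall (0 : E) 1).image_of_continuousOn hfc).isClosed
    have himage : f '' ball 0 1 = ball 0 1 := by
      refine hmaps.antisymm ?_
      have hsub : f '' closedBall 0 1 ∩ ball 0 1 ⊆ f '' ball 0 1 := by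
        rintro _ ⟨⟨x, hx, rfl⟩, hfx⟩
        rcases (mem_closedBall_zero_iff.1 hx).lt_or_eq with hx' | hx'
        · exact ⟨x, by simpa using hx', rfl⟩
        · have : f x = x := by simp [f_def, h_def, hs x (by simpa using hx')]
          rw [this] at hfx ⊢
          simp [hx'] at hfx
      -- The image of the open ball is open, and also relatively closed in the ball because boundary
      -- points are fixed; connectedness makes it everything.
      have hpre : IsPreconnected (ball (0 : E) 1) := (convex_ball (0 : E) 1).isPreconnected
      refine hpre.subset_left_of_subset_union hopen hclosed.isOpen_compl ?_ ?_ ?_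
      · exact Set.disjoint_compl_right_iff_subset.2 (Set.image_mono hball)
      · intro y hy
        by_cases hy' : y ∈ f '' closedBall 0 1
        · exact Or.inl (hsub ⟨hy', hy⟩)
        · exact Or.inr hy'
      · exact ⟨f 0, hmaps ⟨0, by simp, rfl⟩, 0, by simp, rfl⟩
    have hfd : ∀ x ∈ ball (0 : E) 1,
        HasFDerivWithinAt f (1 + t • fderiv ℝ h x) (ball 0 1) x := fun x hx =>
      ((hasFDerivAt_id x).add ((hd x (hball hx)).hasFDerivAt.const_smul t)).hasFDerivWithinAt
    have hint := integral_image_eq_integral_abs_det_fderiv_smul volume measurableSet_ball hfd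
      (hinj.mono hball) (fun _ => (1 : ℝ))
    rw [himage] at hint
    simp only [smul_eq_mul, mul_one] at hint
    rw [setIntegral_const, smul_eq_mul, mul_one] at hint
    rw [hint]
    refine setIntegral_congr_fun measurableSet_ball fun x hx => (abs_of_pos (hdet _ ?_)).symm
    rw [dist_eq_norm, add_sub_cancel_left, norm_smul, Real.norm_of_nonneg ht0.le]
    exact (mul_le_mul htδ.le (hL x (hball hx)) (norm_nonneg _) hδ.le).trans_lt hδε
  obtain ⟨N, hN, hNcard⟩ := (Set.Ioo_infinite hδ).exists_subset_card_eq (Module.finrank ℝ E + 1)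
  have hintegrable : ∀ t : ℝ,
      IntegrableOn (fun x => (1 + t • fderiv ℝ h x).det) (ball (0 : E) 1) := fun t =>
    ((ContinuousLinearMap.continuous_det.comp_continuousOn
      (continuousOn_const.add (hcont.const_smul t))).integrableOn_compact
        (isCompact_closedBall 0 1)).mono_set hball
  -- The integral is a polynomial in `t` of degree at most `dim E`, so its constancy on `N` extends
  -- to `t = 1`.
  have hone : ∫ x in ball (0 : E) 1, (1 + fderiv ℝ h x).det = volume.real (ball (0 : E) 1) := by
    rw [integral_congr_ae (.of_forall fun x =>
      ContinuousLinearMap.det_one_add_eq_sum_lagrange N hNcard (fderiv ℝ h x)), integral_finsetSum _ fun t _ => (hintegrable t).const_mul _]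
    simp_rw [integral_const_mul]
    rw [Finset.sum_congr rfl fun t ht => by rw [hvol t (hN ht)], ← Finset.sum_mul,
      ← Polynomial.eval_finsetSum, Lagrange.sum_basis Function.injective_id.injOn
        (Finset.card_pos.1 (by omega)), Polynomial.eval_one, one_mul]
  -- Differentiating `‖r‖² = 1` puts the range of `r'(x)` in the orthogonal complement of `r x ≠ 0`,
  -- so `r'(x)` is singular.
  have hzero : ∀ x ∈ ball (0 : E) 1, (1 + fderiv ℝ h x).det = 0 := by
    intro x hx
    have hrd : HasFDerivAt r (1 + fderiv ℝ h x) x := by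
      have := (hasFDerivAt_id x).add (hd x (hball hx)).hasFDerivAt
      refine this.congr_of_eventuallyEq (.of_forall fun y => ?_)
      simp [h_def]
    have hconst : HasFDerivAt (fun y => ‖r y‖ ^ 2) (0 : E →L[ℝ] ℝ) x := by
      refine (hasFDerivAt_const (1 : ℝ) x).congr_of_eventuallyEq ?_
      filter_upwards [isOpen_ball.mem_nhds hx] with y hy
      simp [hn y (hball hy)]
    have heq := hrd.norm_sq.unique hconst
    by_contra hne
    have hbot : LinearMap.ker ((1 + fderiv ℝ h x : E →L[ℝ] E) : E →ₗ[ℝ] E) = ⊥ := by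
      by_contra hk
      exact hne (LinearMap.det_eq_zero_iff_ker_ne_bot.2 hk)
    obtain ⟨v, hv⟩ := LinearMap.surjective_of_injective (LinearMap.ker_eq_bot.1 hbot) (r x)
    have hv' : (1 + fderiv ℝ h x : E →L[ℝ] E) v = r x := hv
    have h1 : 2 • inner ℝ (r x) ((1 + fderiv ℝ h x : E →L[ℝ] E) v) = 0 :=
      congrArg (fun l : E →L[ℝ] ℝ => l v) heq
    rw [hv', real_inner_self_eq_norm_sq, hn x (hball hx)] at h1
    norm_num at h1
  rw [setIntegral_congr_fun measurableSet_ball hzero] at hone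
  have hpos : 0 < volume.real (ball (0 : E) 1) :=
    ENNReal.toReal_pos (measure_ball_pos _ _ one_pos).ne' measure_ball_lt_top.ne
  simp at hone
  exact hpos.ne hone

open Metric in
/-- A `C¹` map of the closed unit ball into the open unit ball has a fixed point. -/
theorem exists_fixedPoint_of_contDiff_of_norm_lt_one {E : Type*} [NormedAddCommGroup E]
    [InnerProductSpace ℝ E] [FiniteDimensional ℝ E] {g : E → E} (hg : ContDiff ℝ 1 g)
    (hlt : ∀ x ∈ closedBall (0 : E) 1, ‖g x‖ < 1) : ∃ x ∈ closedBall (0 : E) 1, g x = x := by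
  by_contra! hne
  -- The ray from `g x` through `x` meets the sphere at `x + c x • u x`, where `c x` is the larger
  -- root of a quadratic with quarter discriminant `D x`.
  set u : E → E := fun x => x - g x with hu
  set D : E → ℝ := fun x => inner ℝ x (u x) ^ 2 + ‖u x‖ ^ 2 * (1 - ‖x‖ ^ 2) with hD
  set c : E → ℝ := fun x => (-inner ℝ x (u x) + √(D x)) / ‖u x‖ ^ 2 with hc
  have hu0 : ∀ x ∈ closedBall (0 : E) 1, 0 < ‖u x‖ := fun x hx =>
    norm_pos_iff.2 (sub_ne_zero.2 (hne x hx).symm)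
  have hin : ∀ x : E, ‖x‖ = 1 → 0 < inner ℝ x (u x) := by
    intro x hx
    have h1 := real_inner_le_norm x (g x)
    have h2 := hlt x (by simp [hx])
    rw [hu, inner_sub_right, real_inner_self_eq_norm_sq, hx]
    rw [hx] at h1
    linarith
  have hDpos : ∀ x ∈ closedBall (0 : E) 1, 0 < D x := by
    intro x hx
    rcases (mem_closedBall_zero_iff.1 hx).lt_or_eq with h | h
    · have := hu0 x hx
      have h2 : 0 < 1 - ‖x‖ ^ 2 := by nlinarith [norm_nonneg x]
      positivity
    · have := hin x h
      simp only [hD, h]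
      positivity
  have huC : ContDiff ℝ 1 u := contDiff_id.sub hg
  have hDC : ContDiff ℝ 1 D :=
    ((contDiff_id.inner ℝ huC).pow 2).add
      ((huC.norm_sq ℝ).mul (contDiff_const.sub (contDiff_id.norm_sq ℝ)))
  refine not_exists_contDiffAt_retraction_sphere (fun x => x + c x • u x) (fun x hx => ?_)
    (fun x hx => ?_) fun x hx => ?_
  · refine contDiffAt_id.add (ContDiffAt.smul ?_ huC.contDiffAt)
    exact ((contDiff_id.inner ℝ huC).neg.contDiffAt.add
      (hDC.contDiffAt.sqrt (hDpos x hx).ne')).div (huC.norm_sq ℝ).contDiffAt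
        (pow_pos (hu0 x hx) 2).ne'
  · have hx1 : ‖x‖ = 1 := by simpa using hx
    have : c x = 0 := by
      simp [hc, hD, hx1, Real.sqrt_sq (hin x hx1).le]
    simp [this]
  · have h0 := hu0 x hx
    have hsq := Real.sq_sqrt (hDpos x hx).le
    have hcu : c x * ‖u x‖ ^ 2 = -inner ℝ x (u x) + √(D x) := by
      simp only [hc]; field_simp
    have hone : ‖x + c x • u x‖ ^ 2 = 1 := by
      rw [norm_add_sq_real, inner_smul_right, norm_smul, mul_pow, Real.norm_eq_abs, sq_abs]
      have hne' : ‖u x‖ ^ 2 ≠ 0 := (pow_pos h0 2).ne'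
      apply mul_right_cancel₀ hne'
      have h3 : (c x * ‖u x‖ ^ 2 + inner ℝ x (u x)) ^ 2 = D x := by
        rw [hcu]; linear_combination hsq
      simp only [hD] at h3
      linear_combination h3
    nlinarith [norm_nonneg (x + c x • u x)]

open Metric in
/-- **Brouwer's fixed point theorem** for continuous self-maps whose values lie in the closed unit
ball. -/
theorem Continuous.exists_fixedPoint_of_norm_le_one {E : Type*} [NormedAddCommGroup E]
    [InnerProductSpace ℝ E] [FiniteDimensional ℝ E] {f : E → E} (hf : Continuous f)
    (hle : ∀ x, ‖f x‖ ≤ 1) : ∃ x, f x = x := by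
  by_contra! hne
  obtain ⟨z, -, hz⟩ := (isCompact_closedBall (0 : E) 1).exists_isMinOn ⟨0, by simp⟩
    ((hf.sub continuous_id).norm.continuousOn)
  set m := ‖f z - z‖ with hm
  have hm0 : 0 < m := norm_pos_iff.2 (sub_ne_zero.2 (hne z))
  -- Approximating within `ε` and rescaling by `1 + ε` cost at most `2ε = m / 2`, less than the
  -- minimal displacement `m`.
  set ε := m / 4 with hε
  have hε0 : 0 < ε := by positivity
  obtain ⟨g, hgC, hgf, -⟩ := hf.exists_contDiff_approx 1 (continuous_const (y := ε))
    fun _ => hε0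
  have hgn : ∀ x, ‖g x‖ < 1 + ε := fun x => by
    have h1 := hgf x
    rw [dist_eq_norm] at h1
    have h2 := norm_le_norm_add_norm_sub' (g x) (f x)
    linarith [hle x]
  obtain ⟨x, hx, hxg⟩ := exists_fixedPoint_of_contDiff_of_norm_lt_one
    (g := fun x => (1 + ε)⁻¹ • g x) (contDiff_const.smul hgC) fun x _ => by
      rw [norm_smul, Real.norm_of_nonneg (by positivity), inv_mul_lt_iff₀ (by positivity), mul_one]
      exact hgn x
  have hx1 : ‖x‖ ≤ 1 := by simpa using hx
  have hgx : g x = (1 + ε) • x := by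
    rw [← hxg, smul_smul, mul_inv_cancel₀ (by positivity), one_smul, hxg]
  have h1 : m ≤ ‖f x - x‖ := hz hx
  have h2 := hgf x
  rw [dist_eq_norm, hgx] at h2
  have h3 : ‖f x - x‖ ≤ ‖(1 + ε) • x - f x‖ + ‖ε • x‖ := by
    have : -(f x - x) = (1 + ε) • x - f x - ε • x := by rw [add_smul, one_smul]; abel
    rw [← norm_neg (f x - x), this]
    exact norm_sub_le _ _
  rw [norm_smul, Real.norm_of_nonneg hε0.le] at h3
  have : ε * ‖x‖ ≤ ε := mul_le_of_le_one_right hε0.le hx1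
  linarith

/-- **Brouwer's fixed point theorem** for bounded continuous self-maps of `κ → ℝ`. -/
theorem Continuous.exists_fixedPoint_of_forall_abs_le {κ : Type*} [Fintype κ]
    {f : (κ → ℝ) → κ → ℝ} (hf : Continuous f) {R : ℝ} (hR : ∀ x k, |f x k| ≤ R) :
    ∃ x, f x = x := by
  set e := EuclideanSpace.equiv κ ℝ
  obtain ⟨S, hS0, hS⟩ : ∃ S : ℝ, 0 < S ∧ ∀ x, ‖e.symm (f x)‖ ≤ S := by
    refine ⟨‖(e.symm : (κ → ℝ) →L[ℝ] EuclideanSpace ℝ κ)‖ * max R 0 + 1, by positivity, fun x => ?_⟩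
    refine ((e.symm : (κ → ℝ) →L[ℝ] EuclideanSpace ℝ κ).le_opNorm (f x)).trans ?_
    have : ‖f x‖ ≤ max R 0 := (pi_norm_le_iff_of_nonneg (le_max_right _ _)).2 fun k =>
      (hR x k).trans (le_max_left _ _)
    have := mul_le_mul_of_nonneg_left this (norm_nonneg (e.symm : (κ → ℝ) →L[ℝ] EuclideanSpace ℝ κ))
    linarith
  obtain ⟨x, hx⟩ := Continuous.exists_fixedPoint_of_norm_le_one
    (f := fun x => S⁻¹ • e.symm (f (e (S • x)))) (by fun_prop) fun x => by
      rw [norm_smul, Real.norm_of_nonneg (by positivity), inv_mul_le_iff₀ hS0, mul_one]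
      exact hS _
  refine ⟨e (S • x), e.symm.injective ?_⟩
  rw [e.symm_apply_apply]
  nth_rewrite 2 [← hx]
  rw [smul_smul, mul_inv_cancel₀ hS0.ne', one_smul]

/-! ### Prices, costates and the expansion of the cost. -/

namespace DemandGame

variable {ι : Type*} [Fintype ι] {T : ℕ}

theorem price_zero (G : DemandGame ι T) (s : Fin T → ℝ) (d : ι → Fin T → ℝ) :
    G.price s d 0 = G.p₁ := rfl

theorem price_succ (G : DemandGame ι T) (s : Fin T → ℝ) (d : ι → Fin T → ℝ) (t : Fin T) :
    G.price s d t.succ = (1 + G.ω t) * G.price s d t.castSucc + G.γ * (∑ i, d i t - s t) := rfl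

/-- The change of the prices caused by the change `e` of the total demand. -/
noncomputable def priceShift (G : DemandGame ι T) (e : Fin T → ℝ) : Fin (T + 1) → ℝ :=
  Fin.induction 0 fun t p => (1 + G.ω t) * p + G.γ * e t

theorem priceShift_zero (G : DemandGame ι T) (e : Fin T → ℝ) : G.priceShift e 0 = 0 := rfl

theorem priceShift_succ (G : DemandGame ι T) (e : Fin T → ℝ) (t : Fin T) :
    G.priceShift e t.succ = (1 + G.ω t) * G.priceShift e t.castSucc + G.γ * e t := rfl

theorem priceShift_smul (G : DemandGame ι T) (a : ℝ) (e : Fin T → ℝ) (k : Fin (T + 1)) :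
    G.priceShift (a • e) k = a * G.priceShift e k := by
  induction k using Fin.induction with
  | zero => simp [priceShift_zero]
  | succ t ih => rw [priceShift_succ, priceShift_succ, ih, Pi.smul_apply, smul_eq_mul]; ring

theorem price_update [DecidableEq ι] (G : DemandGame ι T) (s : Fin T → ℝ) (d : ι → Fin T → ℝ)
    (i : ι) (x : Fin T → ℝ) (k : Fin (T + 1)) :
    G.price s (Function.update d i x) k = G.price s d k + G.priceShift (x - d i) k := by
  induction k using Fin.induction with
  | zero => simp [priceShift_zero, price_zero]
  | succ t ih =>
    have hsum : ∑ j, Function.update d i x j t = ∑ j, d j t + (x t - d i t) := by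
      rw [← Finset.add_sum_erase _ _ (Finset.mem_univ i),
        ← Finset.add_sum_erase (a := i) _ (fun j => d j t) (Finset.mem_univ i)]
      have : ∑ j ∈ Finset.univ.erase i, Function.update d i x j t =
          ∑ j ∈ Finset.univ.erase i, d j t :=
        Finset.sum_congr rfl fun j hj => by
          rw [Function.update_of_ne (Finset.ne_of_mem_erase hj)]
      rw [this, Function.update_self]; ring
    rw [price_succ, price_succ, priceShift_succ, ih, hsum, Pi.sub_apply]; ring

theorem price_le_price (G : DemandGame ι T) (hγ : 0 ≤ G.γ) (hω : ∀ t, -1 ≤ G.ω t)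
    (s : Fin T → ℝ) {d d' : ι → Fin T → ℝ} (h : ∀ i t, d i t ≤ d' i t) (k : Fin (T + 1)) :
    G.price s d k ≤ G.price s d' k := by
  induction k using Fin.induction with
  | zero => rfl
  | succ t ih =>
    rw [price_succ, price_succ]
    have : 0 ≤ 1 + G.ω t := by linarith [hω t]
    gcongr
    exact h _ _

/-- The costates `λ₁, …, λ_{T+1}` generated by the demand schedule `x` of a single user. -/
noncomputable def costate (G : DemandGame ι T) (x : Fin T → ℝ) : Fin (T + 1) → ℝ :=
  Fin.reverseInduction 0 fun t l => (1 + G.ω t) * l + x t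

theorem costate_last (G : DemandGame ι T) (x : Fin T → ℝ) : G.costate x (Fin.last T) = 0 := by
  simp [costate]

theorem costate_castSucc (G : DemandGame ι T) (x : Fin T → ℝ) (t : Fin T) :
    G.costate x t.castSucc = (1 + G.ω t) * G.costate x t.succ + x t := by
  simp [costate]

theorem costate_nonneg (G : DemandGame ι T) (hω : ∀ t, -1 ≤ G.ω t) {x : Fin T → ℝ}
    (hx : ∀ t, 0 ≤ x t) (k : Fin (T + 1)) : 0 ≤ G.costate x k := by
  induction k using Fin.reverseInduction with
  | last => rw [costate_last]
  | cast t ih =>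
    rw [costate_castSucc]
    have : 0 ≤ 1 + G.ω t := by linarith [hω t]
    have := hx t
    positivity

/-- The costates are adjoint to the price shifts. -/
theorem sum_priceShift_mul (G : DemandGame ι T) (e x : Fin T → ℝ) :
    ∑ t : Fin T, G.priceShift e t.castSucc * x t =
      ∑ t : Fin T, G.γ * G.costate x t.succ * e t := by
  -- Summation by parts: the boundary terms vanish since the shift starts at 0 and the costate ends
  -- at 0.
  have h1 := Fin.sum_univ_succ fun k => G.costate x k * G.priceShift e k
  have h2 := Fin.sum_univ_castSucc fun k => G.costate x k * G.priceShift e k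
  rw [h1, priceShift_zero, costate_last, mul_zero, zero_mul, zero_add, add_zero] at h2
  rw [← sub_eq_zero, ← Finset.sum_sub_distrib] at h2 ⊢
  rw [← neg_eq_zero, ← Finset.sum_neg_distrib]
  refine (Finset.sum_congr rfl fun t _ => ?_).trans h2
  rw [priceShift_succ, costate_castSucc]; ring

/-- The derivative of the cost of user `i` with respect to the own demand in the slot `t`. -/
noncomputable def marginalCost (G : DemandGame ι T) (s : Fin T → ℝ) (d : ι → Fin T → ℝ) (i : ι)
    (t : Fin T) : ℝ :=
  -G.ψ i t + G.price s d t.castSucc + G.γ * G.costate (d i) t.succ + G.α i t * d i t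

/-- The second-order part of the cost of user `i` along the change `e` of the own schedule. -/
noncomputable def ownCurvature (G : DemandGame ι T) (i : ι) (e : Fin T → ℝ) : ℝ :=
  ∑ t : Fin T, (G.priceShift e t.castSucc * e t + 1 / 2 * G.α i t * e t ^ 2)

theorem ownCurvature_smul (G : DemandGame ι T) (i : ι) (a : ℝ) (e : Fin T → ℝ) :
    G.ownCurvature i (a • e) = a ^ 2 * G.ownCurvature i e := by
  rw [ownCurvature, ownCurvature, Finset.mul_sum]
  refine Finset.sum_congr rfl fun t _ => ?_
  rw [priceShift_smul, Pi.smul_apply, smul_eq_mul]; ring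

/-- The expansion is exact, as prices are affine in demand; adjointness turns the price shift times
the old demand into the costate term. -/
theorem cost_update_add [DecidableEq ι] (G : DemandGame ι T) (s : Fin T → ℝ)
    (d : ι → Fin T → ℝ) (i : ι) (e : Fin T → ℝ) :
    G.cost s (Function.update d i (d i + e)) i =
      G.cost s d i + ∑ t, G.marginalCost s d i t * e t + G.ownCurvature i e := by
  have h := G.sum_priceShift_mul e (d i)
  rw [← sub_eq_zero, ← Finset.sum_sub_distrib] at h
  rw [cost, cost, ownCurvature, ← Finset.sum_add_distrib, ← Finset.sum_add_distrib,
    ← sub_eq_zero, ← Finset.sum_sub_distrib]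
  refine (Finset.sum_congr rfl fun t _ => ?_).trans h
  rw [price_update, Function.update_self, add_sub_cancel_left, marginalCost, Pi.add_apply]
  ring

theorem cost_update_add_single [DecidableEq ι] (G : DemandGame ι T) (s : Fin T → ℝ)
    (d : ι → Fin T → ℝ) (i : ι) (t : Fin T) (a : ℝ) :
    G.cost s (Function.update d i (d i + a • Pi.single t 1)) i =
      G.cost s d i + a * G.marginalCost s d i t + a ^ 2 * G.ownCurvature i (Pi.single t 1) := by
  rw [cost_update_add, ownCurvature_smul]
  congr 2
  rw [Finset.sum_eq_single t (fun u _ hu => by simp [hu]) (by simp)]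
  simp [mul_comm]

/-! ### Equilibrium and complementarity. -/

theorem nonneg_of_forall_quadratic_nonneg {F Q c : ℝ} (hc : 0 < c)
    (h : ∀ a : ℝ, 0 < a → a ≤ c → 0 ≤ a * F + a ^ 2 * Q) : 0 ≤ F := by
  by_contra! hF
  -- At this size `a * |Q| < -F / 2`, so the linear term dominates.
  have hb : 0 < -F / (2 * (|Q| + 1)) := div_pos (by linarith) (by positivity)
  set a := min c (-F / (2 * (|Q| + 1))) with ha
  have ha0 : 0 < a := lt_min hc hb
  have h1 := h a ha0 (min_le_left _ _)
  have h2 : a * (2 * (|Q| + 1)) ≤ -F := (le_div_iff₀ (by positivity)).1 (min_le_right _ _)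
  have h3 : 0 ≤ F + a * Q := by
    by_contra! hneg
    nlinarith
  nlinarith [le_abs_self Q, abs_nonneg Q]

/-- The complementarity conditions: marginal costs are nonnegative, and vanish in the slots with
positive demand. -/
structure IsComplementary (G : DemandGame ι T) (s : Fin T → ℝ) (d : ι → Fin T → ℝ) : Prop where
  demand_nonneg : ∀ i t, 0 ≤ d i t
  marginalCost_nonneg : ∀ i t, 0 ≤ G.marginalCost s d i t
  marginalCost_mul_demand : ∀ i t, G.marginalCost s d i t * d i t = 0

theorem IsNash.isComplementary [DecidableEq ι] {G : DemandGame ι T} {s : Fin T → ℝ}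
    {d : ι → Fin T → ℝ} (h : G.IsNash s d) : G.IsComplementary s d := by
  have key : ∀ i t a, 0 ≤ d i t + a →
      0 ≤ a * G.marginalCost s d i t + a ^ 2 * G.ownCurvature i (Pi.single t 1) := by
    intro i t a ha
    have := h.2 i (d i + a • Pi.single t 1) fun u => by
      by_cases hu : u = t
      · subst hu; simpa using ha
      · simpa [hu] using h.1 i u
    rw [cost_update_add_single] at this
    linarith
  have hF : ∀ i t, 0 ≤ G.marginalCost s d i t := fun i t =>
    nonneg_of_forall_quadratic_nonneg one_pos fun a ha _ =>
      key i t a (add_nonneg (h.1 i t) ha.le)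
  refine ⟨h.1, hF, fun i t => ?_⟩
  rcases (h.1 i t).eq_or_lt with h0 | h0
  · rw [← h0, mul_zero]
  · have : 0 ≤ -G.marginalCost s d i t :=
      nonneg_of_forall_quadratic_nonneg h0 fun a _ ha => by
        have := key i t (-a) (by linarith)
        linarith
    rw [le_antisymm (by linarith) (hF i t), zero_mul]

theorem IsComplementary.nashRelations {G : DemandGame ι T} (hα : ∀ i t, 0 < G.α i t)
    {s : Fin T → ℝ} {d : ι → Fin T → ℝ} (h : G.IsComplementary s d) :
    G.NashRelations s d (G.price s d) fun i => G.costate (d i) where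
  price_init := rfl
  price_step _ := rfl
  costate_final _ := G.costate_last _
  costate_step _ _ := G.costate_castSucc _ _
  response i t := by
    have hα := hα i t
    have hF := h.marginalCost_nonneg i t
    have heq : (G.ψ i t - G.price s d t.castSucc - G.γ * G.costate (d i) t.succ) / G.α i t =
        d i t - G.marginalCost s d i t / G.α i t := by
      rw [marginalCost]; field_simp; ring
    rw [heq]
    rcases mul_eq_zero.1 (h.marginalCost_mul_demand i t) with h0 | h0
    · simp [h0, h.demand_nonneg i t]
    · rw [h0, max_eq_right]
      rw [zero_sub, neg_nonpos]
      positivity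

theorem IsComplementary.isNash [DecidableEq ι] {G : DemandGame ι T} {s : Fin T → ℝ}
    {d : ι → Fin T → ℝ} (h : G.IsComplementary s d) (hconv : G.OwnCostConvex s) :
    G.IsNash s d := by
  refine ⟨h.demand_nonneg, fun i x hx => ?_⟩
  set e := x - d i with he
  have hlin : 0 ≤ ∑ t, G.marginalCost s d i t * e t := Finset.sum_nonneg fun t _ => by
    rw [he, Pi.sub_apply, mul_sub, h.marginalCost_mul_demand, sub_zero]
    exact mul_nonneg (h.marginalCost_nonneg i t) (hx t)
  -- Convexity at the midpoint alone forces the curvature along `e` to be nonnegative.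
  have hmid := (hconv d i).2 (h.demand_nonneg i) hx (show (0 : ℝ) ≤ 1 / 2 by norm_num)
    (show (0 : ℝ) ≤ 1 / 2 by norm_num) (by norm_num)
  have h1 : (1 / 2 : ℝ) • d i + (1 / 2 : ℝ) • x = d i + (1 / 2 : ℝ) • e := by
    ext t
    simp only [he, Pi.add_apply, Pi.smul_apply, Pi.sub_apply, smul_eq_mul]
    ring
  have h2 : x = d i + e := by simp [he]
  simp only [h1, Function.update_eq_self, smul_eq_mul] at hmid
  rw [h2] at hmid ⊢
  rw [cost_update_add, cost_update_add, ownCurvature_smul] at hmid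
  rw [cost_update_add]
  have h3 : ∑ t, G.marginalCost s d i t * ((1 / 2 : ℝ) • e) t =
      1 / 2 * ∑ t, G.marginalCost s d i t * e t := by
    rw [Finset.mul_sum]
    exact Finset.sum_congr rfl fun t _ => by rw [Pi.smul_apply, smul_eq_mul]; ring
  rw [h3] at hmid
  linarith

/-! ### Existence of a complementary profile. -/

theorem continuous_price (G : DemandGame ι T) (s : Fin T → ℝ) (k : Fin (T + 1)) :
    Continuous fun d : ι → Fin T → ℝ => G.price s d k := by
  induction k using Fin.induction with
  | zero => exact continuous_const
  | succ t ih => simp only [price_succ]; fun_prop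

theorem continuous_costate (G : DemandGame ι T) (k : Fin (T + 1)) :
    Continuous fun x : Fin T → ℝ => G.costate x k := by
  induction k using Fin.reverseInduction with
  | last => simp only [costate_last]; exact continuous_const
  | cast t ih => simp only [costate_castSucc]; fun_prop

theorem continuous_marginalCost (G : DemandGame ι T) (s : Fin T → ℝ) (i : ι) (t : Fin T) :
    Continuous fun d : ι → Fin T → ℝ => G.marginalCost s d i t := by
  have h1 := G.continuous_price s t.castSucc
  have h2 : Continuous fun d : ι → Fin T → ℝ => G.costate (d i) t.succ :=
    (G.continuous_costate t.succ).comp (continuous_apply i)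
  unfold marginalCost
  fun_prop

/-- For nonnegative demands, marginal costs are positive at large own demands. -/
theorem exists_marginalCost_pos (G : DemandGame ι T) (hG : G.Admissible)
    (hω : ∀ t, -1 ≤ G.ω t) (s : Fin T → ℝ) :
    ∃ R > 0, ∀ d : ι → Fin T → ℝ, (∀ i t, 0 ≤ d i t) → ∀ i t, R ≤ d i t →
      0 < G.marginalCost s d i t := by
  obtain ⟨M, hM⟩ := (Set.finite_range fun k : ι × Fin T =>
    (G.ψ k.1 k.2 - G.price s 0 k.2.castSucc) / G.α k.1 k.2).bddAbove
  refine ⟨max M 0 + 1, by positivity, fun d hd i t hR => ?_⟩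
  have h1 : (G.ψ i t - G.price s 0 t.castSucc) / G.α i t ≤ M := hM ⟨(i, t), rfl⟩
  have hα := hG.α_pos i t
  have h2 : G.ψ i t - G.price s 0 t.castSucc < G.α i t * d i t := by
    rw [mul_comm, ← div_lt_iff₀ hα]
    linarith [le_max_left M 0]
  -- With `1 + ω ≥ 0`, others' demand can only raise the price, so zero demand gives a bound uniform
  -- in `d`.
  have h3 := G.price_le_price hG.γ_pos.le hω s (d := 0) (d' := d) hd t.castSucc
  have h4 := mul_nonneg hG.γ_pos.le (G.costate_nonneg hω (hd i) t.succ)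
  rw [marginalCost]
  linarith

/-- Clipping the gradient step to `[0, R]` makes the map bounded; the upper clip is inactive at a
fixed point because marginal cost is positive from `R` on. -/
theorem exists_isComplementary (G : DemandGame ι T) (hG : G.Admissible)
    (hω : ∀ t, -1 ≤ G.ω t) (s : Fin T → ℝ) : ∃ d : ι → Fin T → ℝ, G.IsComplementary s d := by
  obtain ⟨R, hR0, hR⟩ := G.exists_marginalCost_pos hG hω s
  obtain ⟨x, hx⟩ := Continuous.exists_fixedPoint_of_forall_abs_le (R := R)
    (f := fun (x : ι × Fin T → ℝ) k =>
      max 0 (min R (x k - G.marginalCost s (Function.curry x) k.1 k.2)))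
    (continuous_pi fun k => by
      have h1 : Continuous fun x : ι × Fin T → ℝ => Function.curry x :=
        continuous_pi fun i => continuous_pi fun t => continuous_apply (i, t)
      have h2 := (G.continuous_marginalCost s k.1 k.2).comp h1
      simp only [Function.comp_def] at h2
      fun_prop) fun x k => by
      rw [abs_of_nonneg (le_max_left _ _)]
      exact max_le hR0.le (min_le_left _ _)
  set d := Function.curry x
  have hfix : ∀ i t, max 0 (min R (d i t - G.marginalCost s d i t)) = d i t := fun i t =>
    congrFun hx (i, t)
  have hd : ∀ i t, 0 ≤ d i t := fun i t => (le_max_left _ _).trans_eq (hfix i t)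
  have hlt : ∀ i t, d i t < R := by
    intro i t
    by_contra! hle
    have hpos := hR d hd i t hle
    have h1 := hfix i t
    rw [max_eq_right_iff.2 ?_] at h1
    · have := min_le_right R (d i t - G.marginalCost s d i t)
      linarith
    · by_contra! hneg
      rw [max_eq_left hneg.le] at h1
      linarith
  have hcases : ∀ i t, (d i t = 0 ∧ 0 ≤ G.marginalCost s d i t) ∨
      G.marginalCost s d i t = 0 := by
    intro i t
    have h1 := hfix i t
    have h2 := hlt i t
    rcases le_total (min R (d i t - G.marginalCost s d i t)) 0 with h | h
    · rw [max_eq_left h] at h1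
      rw [← h1] at h
      rcases min_le_iff.1 h with h | h
      · linarith
      · exact Or.inl ⟨h1.symm, by linarith⟩
    · rw [max_eq_right h] at h1
      rcases min_choice R (d i t - G.marginalCost s d i t) with h3 | h3 <;> rw [h3] at h1
      · linarith
      · exact Or.inr (by linarith)
  refine ⟨d, hd, fun i t => ?_, fun i t => ?_⟩
  · rcases hcases i t with h | h
    · exact h.2
    · exact h.ge
  · rcases hcases i t with h | h
    · rw [h.1, mul_zero]
    · rw [h, zero_mul]

end DemandGame

theorem lemma1 {ι : Type*} [Fintype ι] [DecidableEq ι] {T : ℕ}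
    (G : DemandGame ι T) (hG : G.Admissible)
    (s : Fin T → ℝ) (hs : ∀ t, 0 ≤ s t) :
    -- every Nash equilibrium response satisfies the relations, without further assumptions
    (∀ d : ι → Fin T → ℝ, G.IsNash s d →
      ∃ (p : Fin (T + 1) → ℝ) (l : ι → Fin (T + 1) → ℝ), G.NashRelations s d p l) ∧
    -- a Nash equilibrium response with these relations exists, if the costs are convex
    ((∀ t, -1 ≤ G.ω t) → G.OwnCostConvex s →
      ∃ (d : ι → Fin T → ℝ) (p : Fin (T + 1) → ℝ) (l : ι → Fin (T + 1) → ℝ),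
        G.IsNash s d ∧ G.NashRelations s d p l) := by
  refine ⟨fun d hd => ⟨_, _, hd.isComplementary.nashRelations hG.α_pos⟩, fun hω hconv => ?_⟩
  obtain ⟨d, hd⟩ := G.exists_isComplementary hG hω s
  exact ⟨d, _, _, hd.isNash hconv, hd.nashRelations hG.α_pos⟩
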